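/- Let $\mathbb{N}=\{0,1,2,\dots\}$ and $\mathbb{Z}^+=\{1,2,3,\dots\}$; a square (fourth power) means the square (fourth power) of an integer. (i) Any $n\in\mathbb{N}$ can be written as $x^2+y^2+z^2+w^2$ with $x,y,z,w\in\mathbb{N}$ such that $P(x,y,z)=0$, whenever $P(x,y,z)$ is among the polynomials $$x(x-y),\quad x(x-2y),\quad (x-y)(x-2y),\quad (x-y)(x-3y),$$ $$x(x+y-z),\quad (x-y)(x+y-z),\quad (x-2y)(x+y-z).$$ (ii) Any $n\in\mathbb{N}$ can be written as $x^2+y^2+z^2+w^2$ with $x,y,z,w\in\mathbb{N}$ such that $(2x-3y)(x+y-z)=0$, provided that $$\{x^2+y^2+13z^2 : x,y,z\in\mathbb{N}\}\supseteq\{8q+5 : q\in\mathbb{N}\}.$$ (iii) Any $n\in\mathbb{Z}^+$ can be written as $x^2+y^2+z^2+w^2$ with $x,y,z,w\in\mathbb{N}$ and $z>0$ such that $(x-y)z$ is a square. (iv) Any $n\in\mathbb{Z}^+$ can be written as $x^2+y^2+z^2+w^2$ with $x,y,z,w\in\mathbb{N}$ and $y>0$ such that $x+4y+4z$ and $9x+3y+3z$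 are the two legs of a right triangle with positive integer sides. (v) Any $n\in\mathbb{Z}^+$ can be written as $x^2+y^2+z^2+w^2$ with $x,y,z\in\mathbb{N}$ and $w\in\mathbb{Z}^+$ such that $x^2y^2+y^2z^2+z^2x^2$ is a square. Also, any $n\in\mathbb{Z}^+$ can be written as $x^2+y^2+z^2+w^2$ with $x,y,z\in\mathbb{Z}$ and $w\in\mathbb{Z}^+$ such that $x^2y^2+4y^2z^2+4z^2x^2$ is a square. (vi) Any $n\in\mathbb{Z}^+$ can be written as $x^2+y^2+z^2+w^2$ with $x,y,z\in\mathbb{N}$ and $w\in\mathbb{Z}^+$ such that $x^4+8y^3z+8yz^3$ is a fourth power. Also, any $n\in\mathbb{Z}^+$ can be written as $x^2+y^2+z^2+w^2$ with $x,y,z\in\mathbb{N}$ and $w\in\mathbb{Z}^+$ such that $x^4+16y^3z+64yz^3$ is a fourth power. -/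

import Mathlib

/-- `a` and `b` are the two legs of a right triangle all of whose sides are positive integers. -/
def AreLegsOfIntegerRightTriangle (a b : ℕ) : Prop :=
  0 < a ∧ 0 < b ∧ ∃ c : ℕ, 0 < c ∧ a ^ 2 + b ^ 2 = c ^ 2

/-!
Every part follows from the Gauss–Legendre three-square theorem (`sum_three_sq`): each `n` not of
the form `4 ^ k * (8 * l + 7)` is a sum of three integer squares.

*Three squares.* Dirichlet's theorem on primes in arithmetic progressions and quadratic reciprocity
for the Jacobi symbol give `b > 0` such that `m = b n - 1` divides some `x² + b`
(`sum_three_sq_of_mod_four_eq_two`, `sum_three_sq_of_odd_of_mod_eight_ne_seven`). The matrix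
`!![(x² + b) / m, x, 1; x, m, 0; 1, 0, n]` is then integral, positive definite and of determinant
`1`, and its form takes the value `n` at `(0, 0, 1)`. By Gauss reduction such a form takes only
values that are sums of three squares (`TernaryForm.exists_eq_sum_three_sq`).

*Other ternary forms.* Three squares representing a small multiple of `n` satisfy, after reordering
and changing signs, congruences which turn them into a representation of `n` by another form:
`2 n` gives `x² + y² + 2 z²`, `5 n` gives `x² + y² + 5 z²`, and `3 n` gives
`w² + 2 (x² + x y + y²)`; the last form at `2 n` gives `w² + 2 t² + 3 z²`. The numbers missed
by the sum of three squares and by the first three of these forms are `4 ^ k * u` with `u` in a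
single class, `7` mod `8`, `14` mod `16`, `3` mod `8` and `5` mod `8` respectively, so no number is
missed by two of these four forms. The form `w² + 2 t² + 3 z²` is only needed for `u ≡ 7` mod `8`.

*Four squares.* Each condition holds identically on either of two linear subspaces, and on these
the sum of four squares is one of the ternary forms above. For example `z = x + y` gives
`w² + 2 (x² + x y + y²)`, where
`x² y² + y² z² + z² x² = (x² + x y + y²)²`, and `(y + z)⁴ - (y - z)⁴ = 8 y³ z + 8 y z³` serves the
fourth powers.
-/

/-! ### Reduction of positive definite ternary forms of determinant one -/

/-- The ternary quadratic form
`a x² + b y² + c z² + 2 r y z + 2 s x z + 2 t x y` with integer coefficients. The factors `2` make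
it correspond to the symmetric integer matrix `!![a, t, s; t, b, r; s, r, c]`. -/
structure TernaryForm where
  a : ℤ
  b : ℤ
  c : ℤ
  r : ℤ
  s : ℤ
  t : ℤ

namespace TernaryForm

/-- The value of the form at `(x, y, z)`. -/
def eval (f : TernaryForm) (x y z : ℤ) : ℤ :=
  f.a * x ^ 2 + f.b * y ^ 2 + f.c * z ^ 2 + 2 * f.r * y * z + 2 * f.s * x * z + 2 * f.t * x * y

/-- The determinant of the symmetric matrix of the form. -/
def det (f : TernaryForm) : ℤ :=
  f.a * f.b * f.c + 2 * f.r * f.s * f.t - f.a * f.r ^ 2 - f.b * f.s ^ 2 - f.c * f.t ^ 2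

/-- The leading `2 × 2` minor of the symmetric matrix of the form. -/
def minor (f : TernaryForm) : ℤ := f.a * f.b - f.t ^ 2

end TernaryForm

theorem Int.exists_two_mul_abs_sub_mul_le (e : ℤ) {d : ℤ} (hd : 0 < d) :
    ∃ k : ℤ, |2 * (e - k * d)| ≤ d := by
  refine ⟨(2 * e + d) / (2 * d), ?_⟩
  have h1 := Int.emod_add_mul_ediv (2 * e + d) (2 * d)
  have h2 := Int.emod_nonneg (2 * e + d) (b := 2 * d) (by omega)
  have h3 := Int.emod_lt_of_pos (2 * e + d) (b := 2 * d) (by omega)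
  rw [abs_le]
  constructor <;> nlinarith

namespace TernaryForm

theorem exists_eq_sum_three_sq_of_a_eq_one {f : TernaryForm} (ha : f.a = 1) (hD : f.minor = 1)
    (hdet : f.det = 1) (x y z : ℤ) : ∃ u v w : ℤ, f.eval x y z = u ^ 2 + v ^ 2 + w ^ 2 := by
  obtain ⟨a, b, c, r, s, t⟩ := f
  simp only [minor, det, eval] at *
  subst ha
  obtain rfl : b = 1 + t ^ 2 := by linarith
  obtain rfl : c = 1 + s ^ 2 + (r - t * s) ^ 2 := by linear_combination hdet
  exact ⟨x + t * y + s * z, y + (r - t * s) * z, z, by ring⟩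

/-- Gauss reduction, a descent on the pair (`f.a`, `f.minor`) in lexicographic order. One has
`a f = (a x + t y + s z)² + g(y, z)`, where the binary form `g = D y² + 2 E y z + F z²` has
leading coefficient `D = f.minor` and determinant `D F - E² = a`. Translating `y` by a multiple
of `z` and exchanging the two lowers the minor unless `3 minor² ≤ 4 a`; translating `x` by a
multiple of `y` and exchanging the two lowers `a` unless `3 a² ≤ 4 minor`. Both inequalities
together force `a = minor = 1`. -/
theorem exists_eq_sum_three_sq (f : TernaryForm) (ha : 0 < f.a) (hD : 0 < f.minor)
    (hdet : f.det = 1) (x y z : ℤ) : ∃ u v w : ℤ, f.eval x y z = u ^ 2 + v ^ 2 + w ^ 2 := by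
  obtain ⟨k, hk⟩ := Int.exists_two_mul_abs_sub_mul_le (f.a * f.r - f.t * f.s) hD
  by_cases hF : f.a * (f.c - 2 * k * f.r + k ^ 2 * f.b) - (f.s - k * f.t) ^ 2 < f.minor
  · have key : f.minor * (f.a * (f.c - 2 * k * f.r + k ^ 2 * f.b) - (f.s - k * f.t) ^ 2)
        = f.a + (f.a * f.r - f.t * f.s - k * f.minor) ^ 2 := by
      simp only [det, minor] at *; linear_combination f.a * hdet
    have hpos : 0 < f.a * (f.c - 2 * k * f.r + k ^ 2 * f.b) - (f.s - k * f.t) ^ 2 :=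
      pos_of_mul_pos_right (key ▸ by positivity) hD.le
    obtain ⟨u, v, w, h⟩ := exists_eq_sum_three_sq
      ⟨f.a, f.c - 2 * k * f.r + k ^ 2 * f.b, f.b, f.r - k * f.b, f.t, f.s - k * f.t⟩
      ha hpos (by simp only [det] at *; linear_combination hdet) x z (y + k * z)
    exact ⟨u, v, w, by rw [← h]; simp only [eval]; ring⟩
  obtain ⟨l, hl⟩ := Int.exists_two_mul_abs_sub_mul_le f.t ha
  have key : f.a * (f.b - 2 * l * f.t + l ^ 2 * f.a) = f.minor + (f.t - l * f.a) ^ 2 := by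
    simp only [minor]; ring
  by_cases hb : f.b - 2 * l * f.t + l ^ 2 * f.a < f.a
  · have hpos : 0 < f.b - 2 * l * f.t + l ^ 2 * f.a :=
      pos_of_mul_pos_right (key ▸ by positivity) ha.le
    obtain ⟨u, v, w, h⟩ := exists_eq_sum_three_sq
      ⟨f.b - 2 * l * f.t + l ^ 2 * f.a, f.a, f.c, f.s, f.r - l * f.s, f.t - l * f.a⟩
      hpos (by simp only [minor] at *; linarith)
      (by simp only [det] at *; linear_combination hdet) (y) (x + l * y) z
    exact ⟨u, v, w, by rw [← h]; simp only [eval]; ring⟩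
  -- No step lowers the pair any more; this is the identity `D F = a + E²` for the
  -- reduced coefficients of `g`.
  have key' : f.minor * (f.a * (f.c - 2 * k * f.r + k ^ 2 * f.b) - (f.s - k * f.t) ^ 2)
        = f.a + (f.a * f.r - f.t * f.s - k * f.minor) ^ 2 := by
      simp only [det, minor] at *; linear_combination f.a * hdet
  push Not at hF hb
  have hE := sq_le_sq' (abs_le.1 hk).1 (abs_le.1 hk).2
  have ht := sq_le_sq' (abs_le.1 hl).1 (abs_le.1 hl).2
  have h1 : 3 * f.minor ^ 2 ≤ 4 * f.a := by nlinarith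
  have h2 : 3 * f.a ^ 2 ≤ 4 * f.minor := by nlinarith
  have ha1 : f.a = 1 := by
    by_contra hne
    have : 2 ≤ f.a := by omega
    have : 3 ≤ f.minor := by nlinarith
    nlinarith
  have hD1 : f.minor = 1 := by nlinarith
  exact exists_eq_sum_three_sq_of_a_eq_one ha1 hD1 hdet x y z
termination_by (f.a.toNat, f.minor.toNat)
decreasing_by
  · apply Prod.Lex.right
    simp only [minor] at *
    omega
  · apply Prod.Lex.left
    omega

end TernaryForm

/-- The hypotheses make `!![(x² + b) / m, x, 1; x, m, 0; 1, 0, n]` an integral positive definite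
matrix of determinant `1`. -/
theorem exists_sum_three_sq_of_dvd {n b m x : ℤ} (hb : 0 < b) (hm : 0 < m)
    (hmn : m = b * n - 1) (hx : m ∣ x ^ 2 + b) : ∃ u v w : ℤ, n = u ^ 2 + v ^ 2 + w ^ 2 := by
  obtain ⟨a, ha⟩ := hx
  have hD : a * m - x ^ 2 = b := by linarith
  have ha0 : 0 < a := pos_of_mul_pos_right (ha ▸ by positivity) hm.le
  obtain ⟨u, v, w, h⟩ := TernaryForm.exists_eq_sum_three_sq ⟨a, m, n, 0, 1, x⟩ ha0
    (by simp only [TernaryForm.minor]; omega)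
    (by simp only [TernaryForm.det]; linear_combination n * hD - hmn) 0 0 1
  exact ⟨u, v, w, by rw [← h]; simp [TernaryForm.eval]⟩

/-! ### The three-square theorem -/

/-- **Dirichlet's theorem** in the form used below. -/
theorem Nat.exists_prime_eq_mul_add {q e : ℕ} (hq : q ≠ 0) (h : e.Coprime q) :
    ∃ p v : ℕ, p.Prime ∧ p = q * v + e := by
  obtain ⟨p, hpe, hp, hmod⟩ := Nat.forall_exists_prime_gt_and_modEq e hq h
  obtain ⟨v, hv⟩ := (Nat.modEq_iff_dvd' hpe.le).1 hmod.symm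
  exact ⟨p, v, hp, by omega⟩

theorem Nat.coprime_four_mul {e n : ℕ} (he : Odd e) (h : e.Coprime n) : e.Coprime (4 * n) :=
  Nat.Coprime.mul_right (Nat.Coprime.pow_right 2 (Nat.coprime_two_right.2 he)) h

section JacobiSymbol

open scoped NumberTheorySymbols

/-- Under the condition on `p` and `b` modulo `4`, reciprocity gives `J(-b | p) = J(p | b)`. -/
theorem prime_dvd_sq_add_of_jacobiSym {p b : ℕ} (hp : p.Prime) (hb : Odd b)
    (h4 : p % 4 = 1 ∨ p % 4 = 3 ∧ b % 4 = 3) (hJ : J(p | b) = 1) :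
    ∃ x : ℤ, (p : ℤ) ∣ x ^ 2 + b := by
  have := Fact.mk hp
  have hpo : Odd p := by rw [Nat.odd_iff]; omega
  have hJ' : J(-(b : ℤ) | p) = 1 := by
    rw [jacobiSym.neg _ hpo]
    rcases h4 with h | ⟨h, h'⟩
    · rw [ZMod.χ₄_nat_one_mod_four h, ← jacobiSym.quadratic_reciprocity_one_mod_four h hb, hJ,
        one_mul]
    · rw [ZMod.χ₄_nat_three_mod_four h, jacobiSym.quadratic_reciprocity_three_mod_four h' h, hJ]
      rfl
  obtain ⟨y, hy⟩ := ZMod.isSquare_of_jacobiSym_eq_one hJ'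
  refine ⟨y.val, ?_⟩
  rw [← ZMod.intCast_zmod_eq_zero_iff_dvd]
  push_cast at hy ⊢
  rw [ZMod.natCast_val, ZMod.cast_id]
  linear_combination -hy

/-- Here `b = 4 v + 1` is chosen such that `p = b n - 1` is prime; as `p ≡ -1` mod `b`, one has
`J(p | b) = J(-1 | b) = 1`. -/
theorem sum_three_sq_of_mod_four_eq_two {n : ℕ} (hn : n % 4 = 2) :
    ∃ u v w : ℤ, (n : ℤ) = u ^ 2 + v ^ 2 + w ^ 2 := by
  obtain ⟨p, v, hp, hpv⟩ := Nat.exists_prime_eq_mul_add (q := 4 * n) (e := n - 1) (by omega)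
    (Nat.coprime_four_mul (by rw [Nat.odd_iff]; omega)
      ((Nat.coprime_self_sub_left (by omega)).2 (by simp)))
  have hp4 : p % 4 = 1 := by rw [hpv, mul_assoc]; omega
  have hbo : Odd (4 * v + 1) := by rw [Nat.odd_iff]; omega
  have hpb : (p : ℤ) = -1 + ((4 * v + 1 : ℕ) : ℤ) * n := by
    zify [show 1 ≤ n by omega] at hpv ⊢
    linear_combination hpv
  have hJ : J(p | 4 * v + 1) = 1 := by
    rw [jacobiSym.mod_left' (a₂ := -1) (by rw [hpb, Int.add_mul_emod_self_left]),
      jacobiSym.at_neg_one hbo, ZMod.χ₄_nat_one_mod_four (by omega)]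
  obtain ⟨x, hx⟩ := prime_dvd_sq_add_of_jacobiSym hp hbo (Or.inl hp4) hJ
  exact exists_sum_three_sq_of_dvd (by positivity) (by exact_mod_cast hp.pos)
    (by linarith) hx

/-- Here `b = 8 v + c` is chosen such that `2 p = b n - 1` with `p` prime. As `-2 p ≡ 1` mod `b` and
`b` is `1` or `3` mod `8`, one has `J(p | b) = J(-2 | b) = 1`. -/
theorem sum_three_sq_of_odd_of_mod_eight_ne_seven {n : ℕ} (hn : n % 2 = 1) (h7 : n % 8 ≠ 7) :
    ∃ u v w : ℤ, (n : ℤ) = u ^ 2 + v ^ 2 + w ^ 2 := by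
  -- `c = 1` if `n ≡ 3` mod `8` and `c = 3` otherwise; then `e = (c n - 1) / 2` is odd.
  obtain ⟨c, e, hce, hcond⟩ : ∃ c e : ℕ, 2 * e + 1 = c * n ∧
      (c % 8 = 1 ∧ e % 4 = 1 ∨ c % 8 = 3 ∧ e % 2 = 1) := by
    by_cases h3 : n % 8 = 3
    · exact ⟨1, n / 2, by omega, by omega⟩
    · exact ⟨3, 3 * n / 2, by omega, by omega⟩
  have hen : e.Coprime n := by
    have : (2 * e).Coprime (2 * e + 1) := by simp
    rw [hce] at this
    exact (this.coprime_dvd_left ⟨2, by ring⟩).coprime_dvd_right ⟨c, by ring⟩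
  obtain ⟨p, v, hp, hpv⟩ := Nat.exists_prime_eq_mul_add (q := 4 * n) (by omega)
    (Nat.coprime_four_mul (by rw [Nat.odd_iff]; omega) hen)
  set b := 8 * v + c with hb
  have hbo : Odd b := by rw [Nat.odd_iff]; omega
  have hp4 : p % 4 = e % 4 := by rw [hpv, mul_assoc]; omega
  have hpb : 2 * (p : ℤ) = b * n - 1 := by
    rw [hb]
    zify at hpv hce ⊢
    linear_combination 2 * hpv + hce
  have hJ2 : J(-2 | b) = 1 := by
    rw [jacobiSym.at_neg_two hbo, ZMod.χ₈'_nat_eq_if_mod_eight, if_neg (by omega),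
      if_pos (by omega)]
  have hJ : J(p | b) = 1 := by
    have hmod : (-2 * (p : ℤ)) % b = 1 % b := by
      rw [show -2 * (p : ℤ) = 1 + b * (-n) by linear_combination -hpb, Int.add_mul_emod_self_left]
    calc J(p | b) = J(-2 | b) * J(p | b) := by rw [hJ2, one_mul]
      _ = 1 := by rw [← jacobiSym.mul_left, jacobiSym.mod_left' hmod, jacobiSym.one_left]
  obtain ⟨x, hx⟩ := prime_dvd_sq_add_of_jacobiSym hp hbo (by omega) hJ
  have hpo : Odd (p : ℤ) := by rw [Int.odd_iff]; omega
  have hbo' : Odd (b : ℤ) := by exact_mod_cast hbo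
  -- An odd square root of `-b` modulo `p` is one modulo `2 p`, too.
  obtain ⟨y, hyo, hy⟩ : ∃ y : ℤ, Odd y ∧ (p : ℤ) ∣ y ^ 2 + b := by
    rcases Int.even_or_odd x with h | h
    · exact ⟨x + p, h.add_odd hpo,
        by rw [show (x + p) ^ 2 + (b : ℤ) = x ^ 2 + b + p * (2 * x + p) by ring]
           exact dvd_add hx (dvd_mul_right _ _)⟩
    · exact ⟨x, h, hx⟩
  have hdvd : 2 * (p : ℤ) ∣ y ^ 2 + b :=
    IsCoprime.mul_dvd (Int.isCoprime_two_left.2 hpo)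
      (even_iff_two_dvd.1 (hyo.pow.add_odd hbo')) hy
  exact exists_sum_three_sq_of_dvd (by exact_mod_cast hbo.pos)
    (by have := hp.pos; omega) hpb hdvd

end JacobiSymbol

/-- The **three-square theorem** of Gauss and Legendre. -/
theorem sum_three_sq {n : ℕ} (h : ∀ k l, n ≠ 4 ^ k * (8 * l + 7)) :
    ∃ x y z : ℤ, (n : ℤ) = x ^ 2 + y ^ 2 + z ^ 2 := by
  induction n using Nat.strong_induction_on with
  | _ n ih =>
    by_cases h0 : n = 0
    · exact ⟨0, 0, 0, by simp [h0]⟩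
    by_cases h4 : n % 4 = 0
    · obtain ⟨m, rfl⟩ := Nat.dvd_of_mod_eq_zero h4
      obtain ⟨x, y, z, hm⟩ := ih m (by omega)
        fun k l hkl => h (k + 1) l (by rw [hkl]; ring)
      exact ⟨2 * x, 2 * y, 2 * z, by push_cast; rw [hm]; ring⟩
    by_cases h2 : n % 4 = 2
    · exact sum_three_sq_of_mod_four_eq_two h2
    · refine sum_three_sq_of_odd_of_mod_eight_ne_seven (by omega) fun h7 => ?_
      exact h 0 (n / 8) (by omega)

/-! ### Further ternary forms -/

theorem Nat.four_pow_mul_ne {k l u v : ℕ} (hu : u % 4 ≠ 0) (hv : v % 4 ≠ 0) (huv : u ≠ v) :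
    4 ^ k * u ≠ 4 ^ l * v := by
  induction k generalizing l with
  | zero =>
    cases l with
    | zero => simpa using huv
    | succ l => rw [pow_succ', mul_assoc]; omega
  | succ k ih =>
    cases l with
    | zero => rw [pow_succ', mul_assoc]; omega
    | succ l => have := ih (l := l); rw [pow_succ', pow_succ', mul_assoc, mul_assoc]; omega

theorem Int.sq_emod_four_eq_zero_or_one (x : ℤ) : x ^ 2 % 4 = x % 2 := by
  rcases Int.emod_two_eq_zero_or_one x with h | h <;>
  · obtain ⟨k, rfl | rfl⟩ := Int.even_or_odd' x <;> ring_nf <;> omega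

theorem exists_sum_three_sq {n : ℕ} (h : ∀ k l, n ≠ 4 ^ k * (8 * l + 7)) :
    ∃ x y z : ℕ, n = x ^ 2 + y ^ 2 + z ^ 2 := by
  obtain ⟨x, y, z, hn⟩ := sum_three_sq h
  exact ⟨x.natAbs, y.natAbs, z.natAbs, by zify; simpa using hn⟩

/-- Halve a representation of `2 n` as a sum of three squares: `n = d² + (v + d)² + 2 e²` if
`2 n = (v + 2 d)² + v² + (2 e)²`. -/
theorem exists_sq_add_sq_add_two_mul_sq {n : ℕ} (h : ∀ k l, n ≠ 4 ^ k * (16 * l + 14)) :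
    ∃ x y z : ℕ, n = x ^ 2 + y ^ 2 + 2 * z ^ 2 := by
  obtain ⟨x, y, z, hn⟩ := sum_three_sq (n := 2 * n) fun k l hkl => by
    cases k with
    | zero => omega
    | succ k => exact h k l (by rw [pow_succ] at hkl; linarith)
  -- The sum of the squares is even, so one term is even and the other two have equal parity.
  have key : ∀ u v w : ℤ, (2 * n : ℤ) = u ^ 2 + v ^ 2 + w ^ 2 → u % 2 = v % 2 → w % 2 = 0 →
      ∃ x y z : ℕ, n = x ^ 2 + y ^ 2 + 2 * z ^ 2 := by
    intro u v w hn huv hw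
    obtain ⟨d, hd⟩ : (2 : ℤ) ∣ u - v := by omega
    obtain ⟨e, rfl⟩ : (2 : ℤ) ∣ w := by omega
    obtain rfl : u = v + 2 * d := by linarith
    refine ⟨(v + d).natAbs, d.natAbs, e.natAbs, ?_⟩
    zify
    simp only [sq_abs]
    linarith
  push_cast at hn
  have hx := x.sq_emod_four_eq_zero_or_one
  have hy := y.sq_emod_four_eq_zero_or_one
  have hz := z.sq_emod_four_eq_zero_or_one
  by_cases h1 : x % 2 = y % 2
  · exact key x y z hn h1 (by omega)
  by_cases h2 : x % 2 = z % 2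
  · exact key x z y (by linarith) h2 (by omega)
  · exact key y z x (by linarith) (by omega) (by omega)

/-- Divide a representation of `5 n` as a sum of three squares by `5`:
`n = (v + 2 d)² + d² + 5 e²` if `5 n = (2 v + 5 d)² + v² + (5 e)²`. -/
theorem exists_sq_add_sq_add_five_mul_sq {n : ℕ} (h : ∀ k l, n ≠ 4 ^ k * (8 * l + 3)) :
    ∃ x y z : ℕ, n = x ^ 2 + y ^ 2 + 5 * z ^ 2 := by
  obtain ⟨x, y, z, hn⟩ := sum_three_sq (n := 5 * n) fun k l hkl => by
    have h5 : 5 ∣ 8 * l + 7 :=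
      (Nat.Coprime.pow_right k (by norm_num : Nat.Coprime 5 4)).dvd_of_dvd_mul_left ⟨n, hkl.symm⟩
    obtain ⟨j, rfl⟩ : ∃ j, l = 5 * j + 1 := ⟨l / 5, by omega⟩
    exact h k j (by linarith)
  have key : ∀ u v w : ℤ, (5 * n : ℤ) = u ^ 2 + v ^ 2 + w ^ 2 → (5 : ℤ) ∣ u - 2 * v → (5 : ℤ) ∣ w →
      ∃ x y z : ℕ, n = x ^ 2 + y ^ 2 + 5 * z ^ 2 := by
    rintro u v _ hn ⟨d, hd⟩ ⟨e, rfl⟩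
    obtain rfl : u = 2 * v + 5 * d := by linarith
    refine ⟨(v + 2 * d).natAbs, d.natAbs, e.natAbs, ?_⟩
    zify
    simp only [sq_abs]
    linarith
  have key' : ∀ u v w : ℤ, (5 * n : ℤ) = u ^ 2 + v ^ 2 + w ^ 2 →
      (5 : ℤ) ∣ (u - 2 * v) * (u + 2 * v) → (5 : ℤ) ∣ w →
      ∃ x y z : ℕ, n = x ^ 2 + y ^ 2 + 5 * z ^ 2 := by
    intro u v w hn huv hw
    rcases Int.Prime.dvd_mul' (p := 5) (by norm_num) huv with h | h
    · exact key u v w hn h hw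
    · exact key u (-v) w (by rw [hn]; ring) (by simpa using h) hw
  push_cast at hn
  -- Squares are `0, 1, 4` mod `5`, so one of the three vanishes and the other two are opposite.
  have mod5 : ∀ u : ℤ, u % 5 = 0 ∧ u ^ 2 % 5 = 0 ∨ u ^ 2 % 5 = 1 ∨ u ^ 2 % 5 = 4 := by
    intro u
    have := Int.emod_nonneg u (b := 5) (by norm_num)
    have := Int.emod_lt_of_pos u (b := 5) (by norm_num)
    rw [pow_two, Int.mul_emod]
    interval_cases h : u % 5 <;> simp
  have hfac : ∀ u v : ℤ, (u - 2 * v) * (u + 2 * v) = u ^ 2 - 4 * v ^ 2 := fun u v => by ring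
  rcases mod5 z with hz | hz
  · exact key' x y z hn (by rw [hfac]; omega) (by omega)
  rcases mod5 y with hy | hy
  · exact key' x z y (by linarith) (by rw [hfac]; omega) (by omega)
  rcases mod5 x with hx | hx
  · exact key' y z x (by linarith) (by rw [hfac]; omega) (by omega)
  · omega

/-- The norm form `x² + x y + y²` of the hexagonal lattice takes each of its values at a point with
nonnegative coordinates, as the units of the lattice move every point into that sector. -/
theorem Int.exists_nat_sq_add_mul_add_sq (x y : ℤ) :
    ∃ a b : ℕ, x ^ 2 + x * y + y ^ 2 = (a : ℤ) ^ 2 + a * b + b ^ 2 := by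
  wlog hx : 0 ≤ x generalizing x y
  · obtain ⟨a, b, h⟩ := this (-x) (-y) (by omega)
    exact ⟨a, b, by rw [← h]; ring⟩
  lift x to ℕ using hx
  obtain ⟨m, rfl | rfl⟩ := y.eq_nat_or_neg
  · exact ⟨x, m, rfl⟩
  rcases le_total m x with h | h
  · exact ⟨x - m, m, by push_cast [h]; ring⟩
  · exact ⟨m - x, x, by push_cast [h]; ring⟩

/-- Divide a representation of `3 n` as a sum of three squares by `3`. If `a ≡ b ≡ c` mod `3`, then
`3 (a² + b² + c²) = (a + b + c)² + 2 ((a - b)² + (a - b) (b - c) + (b - c)²)`,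
where `a + b + c`, `a - b` and `b - c` are divisible by `3`. -/
theorem exists_sq_add_two_mul_hex {n : ℕ} (h : ∀ k l, n ≠ 4 ^ k * (8 * l + 5)) :
    ∃ x y w : ℕ, n = w ^ 2 + 2 * (x ^ 2 + x * y + y ^ 2) := by
  obtain ⟨x, y, z, hn⟩ := sum_three_sq (n := 3 * n) fun k l hkl => by
    have h3 : 3 ∣ 8 * l + 7 :=
      (Nat.Coprime.pow_right k (by norm_num : Nat.Coprime 3 4)).dvd_of_dvd_mul_left ⟨n, hkl.symm⟩
    obtain ⟨j, rfl⟩ : ∃ j, l = 3 * j + 1 := ⟨l / 3, by omega⟩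
    exact h k j (by linarith)
  have sign : ∀ u : ℤ, ∃ v : ℤ, v ^ 2 = u ^ 2 ∧
      (v % 3 = 0 ∧ v ^ 2 % 3 = 0 ∨ v % 3 = 1 ∧ v ^ 2 % 3 = 1) := by
    intro u
    by_cases h2 : u % 3 = 2
    · refine ⟨-u, by ring, Or.inr ⟨by omega, ?_⟩⟩
      rw [pow_two, Int.mul_emod, show -u % 3 = 1 by omega]; rfl
    · refine ⟨u, rfl, ?_⟩
      rcases (by omega : u % 3 = 0 ∨ u % 3 = 1) with h | h <;> simp [pow_two, Int.mul_emod, h]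
  obtain ⟨a, ha, ha'⟩ := sign x
  obtain ⟨b, hb, hb'⟩ := sign y
  obtain ⟨c, hc, hc'⟩ := sign z
  rw [← ha, ← hb, ← hc] at hn
  push_cast at hn
  -- The squares are `0` or `1` mod `3`, so `a`, `b`, `c` are all `0` or all `1` mod `3`.
  obtain ⟨u, hu⟩ : (3 : ℤ) ∣ a - b := by omega
  obtain ⟨v, hv⟩ : (3 : ℤ) ∣ b - c := by omega
  obtain ⟨i, j, hij⟩ := Int.exists_nat_sq_add_mul_add_sq u v
  obtain rfl : a = c + 3 * v + 3 * u := by linarith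
  obtain rfl : b = c + 3 * v := by linarith
  refine ⟨i, j, (c + 2 * v + u).natAbs, ?_⟩
  zify
  rw [sq_abs, ← hij]
  linarith

/-- No `4 ^ k * m` with `m` as stated is a square, so `x` and `y` do not both vanish; for odd `m`,
parity forces `w ≠ 0`. -/
theorem exists_sq_add_two_mul_hex_pos {k m : ℕ} (h8 : m % 8 = 7 ∨ m % 16 = 14) :
    ∃ x y w : ℕ, 0 < y ∧ (m % 2 = 1 → 0 < w) ∧
      4 ^ k * m = w ^ 2 + 2 * (x ^ 2 + x * y + y ^ 2) := by
  obtain ⟨x, y, w, hm⟩ := exists_sq_add_two_mul_hex (n := m) fun k l => by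
    simpa using Nat.four_pow_mul_ne (k := 0) (l := k) (u := m) (v := 8 * l + 5)
      (by omega) (by omega) (by omega)
  have hw : m % 2 = 1 → 0 < w := by
    rintro h
    rcases Nat.eq_zero_or_pos w with rfl | h' <;> omega
  have scale : ∀ x y w : ℕ, 0 < y → (m % 2 = 1 → 0 < w) →
      m = w ^ 2 + 2 * (x ^ 2 + x * y + y ^ 2) → ∃ x y w : ℕ, 0 < y ∧ (m % 2 = 1 → 0 < w) ∧
        4 ^ k * m = w ^ 2 + 2 * (x ^ 2 + x * y + y ^ 2) := by
    intro x y w hy hw hm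
    refine ⟨2 ^ k * x, 2 ^ k * y, 2 ^ k * w, by positivity, fun h => ?_, ?_⟩
    · have := hw h
      positivity
    · rw [hm, show 4 = 2 ^ 2 by rfl, ← pow_mul, mul_comm 2 k, pow_mul]; ring
  rcases Nat.eq_zero_or_pos y with rfl | hy
  · rcases Nat.eq_zero_or_pos x with rfl | hx
    · have h4 := (w : ℤ).sq_emod_four_eq_zero_or_one
      zify at hm h8
      omega
    · exact scale 0 x w hx hw (by rw [hm]; ring)
  · exact scale x y w hy hw hm

/-- One of `x`, `y`, `x + y` is even; if `y = 2 k`, then `x² + x y + y² = (x + k)² + 3 k²`. -/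
theorem exists_hex_eq_sq_add_three_mul_sq (x y : ℕ) :
    ∃ u v : ℤ, (x : ℤ) ^ 2 + x * y + y ^ 2 = u ^ 2 + 3 * v ^ 2 := by
  have key : ∀ x y : ℤ, Even y → ∃ u v : ℤ, x ^ 2 + x * y + y ^ 2 = u ^ 2 + 3 * v ^ 2 := by
    rintro x y ⟨k, rfl⟩
    exact ⟨x + k, k, by ring⟩
  rcases Int.even_or_odd (y : ℤ) with hy | hy
  · exact key x y hy
  rcases Int.even_or_odd (x : ℤ) with hx | hx
  · obtain ⟨u, v, h⟩ := key y x hx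
    exact ⟨u, v, by rw [← h]; ring⟩
  · obtain ⟨u, v, h⟩ := key x (-(x + y)) (hx.add_odd hy).neg
    exact ⟨u, v, by rw [← h]; ring⟩

/-- Halve a representation `16 l + 14 = (2 j)² + 2 (u² + 3 v²)`. The coefficient-one variable `u` is
nonzero because `2 j² + 3 v²` is never `7` mod `8`. -/
theorem exists_sq_add_two_mul_sq_add_three_mul_sq (k l : ℕ) :
    ∃ w t z : ℕ, 0 < w ∧ 4 ^ k * (8 * l + 7) = w ^ 2 + 2 * t ^ 2 + 3 * z ^ 2 := by
  obtain ⟨x, y, w, -, -, h⟩ := exists_sq_add_two_mul_hex_pos (k := 0) (m := 16 * l + 14) (by omega)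
  obtain ⟨u, v, huv⟩ := exists_hex_eq_sq_add_three_mul_sq x y
  have hw : Even w := by
    have : Even (w ^ 2) := by rw [Nat.even_iff]; omega
    exact (Nat.even_pow.1 this).1
  obtain ⟨j, rfl⟩ := hw
  have h1 : (8 * l + 7 : ℤ) = u ^ 2 + 2 * j ^ 2 + 3 * v ^ 2 := by
    zify at h
    linarith
  have hu : u ≠ 0 := by
    rintro rfl
    have hj := (j : ℤ).sq_emod_four_eq_zero_or_one
    have hv := v.sq_emod_four_eq_zero_or_one
    have hv8 : v % 2 = 1 → v ^ 2 % 8 = 1 := fun h => by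
      obtain ⟨i, rfl⟩ := Int.odd_iff.2 h
      obtain ⟨m, hm⟩ := Int.even_mul_succ_self i
      rw [show (2 * i + 1) ^ 2 = 8 * m + 1 by linear_combination 4 * hm]
      omega
    omega
  refine ⟨2 ^ k * u.natAbs, 2 ^ k * j, 2 ^ k * v.natAbs, by positivity, ?_⟩
  have h4 : (4 : ℤ) ^ k = (2 ^ k) ^ 2 := by rw [← pow_mul, mul_comm, pow_mul]; norm_num
  zify
  simp only [mul_pow, sq_abs]
  rw [h4, h1]
  ring

/-! ### Sums of four squares under polynomial conditions -/

/-- If `4 ^ k * (8 l + 7) = u² + v² + 5 z²`, then twice it is `(u + v)² + (u - v)² + 10 z²`. -/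
theorem exists_sq_add_sq_add_ten_mul_sq (k l : ℕ) :
    ∃ x y z : ℕ, 4 ^ k * (16 * l + 14) = x ^ 2 + y ^ 2 + 10 * z ^ 2 := by
  obtain ⟨u, v, z, h⟩ := exists_sq_add_sq_add_five_mul_sq (n := 4 ^ k * (8 * l + 7)) fun k' l' =>
    Nat.four_pow_mul_ne (by omega) (by omega) (by omega)
  refine ⟨u + v, (u - v : ℤ).natAbs, z, ?_⟩
  zify at h ⊢
  rw [sq_abs]
  linear_combination 2 * h

theorem exists_sum_three_sq_pos {n : ℕ} (hn : 0 < n) (h : ∀ k l, n ≠ 4 ^ k * (8 * l + 7)) :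
    ∃ x y z : ℕ, 0 < z ∧ n = x ^ 2 + y ^ 2 + z ^ 2 := by
  obtain ⟨x, y, z, hxyz⟩ := exists_sum_three_sq h
  rcases Nat.eq_zero_or_pos z with rfl | hz
  · rcases Nat.eq_zero_or_pos y with rfl | hy
    · exact ⟨0, 0, x, Nat.pos_of_ne_zero (by rintro rfl; simp at hxyz; omega), by linarith⟩
    · exact ⟨x, 0, y, hy, by linarith⟩
  · exact ⟨x, y, z, hz, hxyz⟩

theorem four_sq_of_polynomial {P : ℤ → ℤ → ℤ → ℤ}
    (hP : P ∈ ({fun x y _ => x * (x - y),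
             fun x y _ => x * (x - 2 * y),
             fun x y _ => (x - y) * (x - 2 * y),
             fun x y _ => (x - y) * (x - 3 * y),
             fun x y z => x * (x + y - z),
             fun x y z => (x - y) * (x + y - z),
             fun x y z => (x - 2 * y) * (x + y - z)} : Set (ℤ → ℤ → ℤ → ℤ))) (n : ℕ) :
    ∃ x y z w : ℕ, n = x ^ 2 + y ^ 2 + z ^ 2 + w ^ 2 ∧ P x y z = 0 := by
  have three : (∃ x y z : ℕ, n = x ^ 2 + y ^ 2 + z ^ 2) ∨ ∃ k l, n = 4 ^ k * (8 * l + 7) := by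
    by_contra! h
    obtain ⟨x, y, z, hn⟩ := exists_sum_three_sq h.2
    exact h.1 x y z hn
  have two : (∃ x y z : ℕ, n = x ^ 2 + y ^ 2 + 2 * z ^ 2) ∨ ∃ k l, n = 4 ^ k * (16 * l + 14) := by
    by_contra! h
    obtain ⟨x, y, z, hn⟩ := exists_sq_add_sq_add_two_mul_sq h.2
    exact h.1 x y z hn
  have five : (∃ x y z : ℕ, n = x ^ 2 + y ^ 2 + 5 * z ^ 2) ∨ ∃ k l, n = 4 ^ k * (8 * l + 3) := by
    by_contra! h
    obtain ⟨x, y, z, hn⟩ := exists_sq_add_sq_add_five_mul_sq h.2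
    exact h.1 x y z hn
  simp only [Set.mem_insert_iff, Set.mem_singleton_iff] at hP
  rcases hP with rfl | rfl | rfl | rfl | rfl | rfl | rfl
  · obtain ⟨x, y, z, hn⟩ | ⟨k, l, rfl⟩ := three
    · exact ⟨0, x, y, z, by rw [hn]; ring, by simp⟩
    · obtain ⟨x, y, z, hn⟩ := exists_sq_add_sq_add_two_mul_sq (n := 4 ^ k * (8 * l + 7))
        fun k' l' => Nat.four_pow_mul_ne (by omega) (by omega) (by omega)
      exact ⟨z, z, x, y, by rw [hn]; ring, by ring⟩
  · obtain ⟨x, y, z, hn⟩ | ⟨k, l, rfl⟩ := three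
    · exact ⟨0, x, y, z, by rw [hn]; ring, by simp⟩
    · obtain ⟨x, y, z, hn⟩ := exists_sq_add_sq_add_five_mul_sq (n := 4 ^ k * (8 * l + 7))
        fun k' l' => Nat.four_pow_mul_ne (by omega) (by omega) (by omega)
      exact ⟨2 * z, z, x, y, by rw [hn]; ring, by push_cast; ring⟩
  · obtain ⟨x, y, z, hn⟩ | ⟨k, l, rfl⟩ := two
    · exact ⟨z, z, x, y, by rw [hn]; ring, by ring⟩
    · obtain ⟨x, y, z, hn⟩ := exists_sq_add_sq_add_five_mul_sq (n := 4 ^ k * (16 * l + 14))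
        fun k' l' => Nat.four_pow_mul_ne (by omega) (by omega) (by omega)
      exact ⟨2 * z, z, x, y, by rw [hn]; ring, by push_cast; ring⟩
  · obtain ⟨x, y, z, hn⟩ | ⟨k, l, rfl⟩ := two
    · exact ⟨z, z, x, y, by rw [hn]; ring, by ring⟩
    · obtain ⟨x, y, z, hn⟩ := exists_sq_add_sq_add_ten_mul_sq k l
      exact ⟨3 * z, z, x, y, by rw [hn]; ring, by push_cast; ring⟩
  · obtain ⟨x, y, z, hn⟩ | ⟨k, l, rfl⟩ := three
    · exact ⟨0, x, y, z, by rw [hn]; ring, by simp⟩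
    · obtain ⟨x, y, w, hn⟩ := exists_sq_add_two_mul_hex (n := 4 ^ k * (8 * l + 7))
        fun k' l' => Nat.four_pow_mul_ne (by omega) (by omega) (by omega)
      exact ⟨x, y, x + y, w, by rw [hn]; ring, by push_cast; ring⟩
  · obtain ⟨x, y, z, hn⟩ | ⟨k, l, rfl⟩ := two
    · exact ⟨z, z, x, y, by rw [hn]; ring, by ring⟩
    · obtain ⟨x, y, w, hn⟩ := exists_sq_add_two_mul_hex (n := 4 ^ k * (16 * l + 14))
        fun k' l' => Nat.four_pow_mul_ne (by omega) (by omega) (by omega)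
      exact ⟨x, y, x + y, w, by rw [hn]; ring, by push_cast; ring⟩
  · obtain ⟨x, y, z, hn⟩ | ⟨k, l, rfl⟩ := five
    · exact ⟨2 * z, z, x, y, by rw [hn]; ring, by push_cast; ring⟩
    · obtain ⟨x, y, w, hn⟩ := exists_sq_add_two_mul_hex (n := 4 ^ k * (8 * l + 3))
        fun k' l' => Nat.four_pow_mul_ne (by omega) (by omega) (by omega)
      exact ⟨x, y, x + y, w, by rw [hn]; ring, by push_cast; ring⟩

/-- Use `z = x + y`, or `(x, y) = (3 u, 2 u)`, whose squares add up to `13 u²`. -/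
theorem four_sq_of_thirteen (h13 : ∀ q : ℕ, ∃ x y z : ℕ, 8 * q + 5 = x ^ 2 + y ^ 2 + 13 * z ^ 2)
    (n : ℕ) : ∃ x y z w : ℕ, n = x ^ 2 + y ^ 2 + z ^ 2 + w ^ 2 ∧
      (2 * (x : ℤ) - 3 * (y : ℤ)) * ((x : ℤ) + (y : ℤ) - (z : ℤ)) = 0 := by
  by_cases h : ∀ k l, n ≠ 4 ^ k * (8 * l + 5)
  · obtain ⟨x, y, w, hn⟩ := exists_sq_add_two_mul_hex h
    exact ⟨x, y, x + y, w, by rw [hn]; ring, by push_cast; ring⟩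
  · push Not at h
    obtain ⟨k, l, rfl⟩ := h
    obtain ⟨x, y, z, hn⟩ := h13 l
    refine ⟨2 ^ k * (3 * z), 2 ^ k * (2 * z), 2 ^ k * x, 2 ^ k * y, ?_, by push_cast; ring⟩
    rw [hn, show 4 = 2 ^ 2 by rfl, ← pow_mul, mul_comm 2 k, pow_mul]
    ring

/-- Use `x = y` if `n` is represented by `x² + y² + 2 z²` with `x`, `y` not both `0`, then
`(x, y, z, w) = (z, 0, z, 0)` if `n = 2 z²`, and `x - y = z` for the remaining `n`. -/
theorem four_sq_sub_mul_isSquare {n : ℕ} (hn : 0 < n) :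
    ∃ x y z w : ℕ, n = x ^ 2 + y ^ 2 + z ^ 2 + w ^ 2 ∧
      0 < z ∧ IsSquare (((x : ℤ) - (y : ℤ)) * (z : ℤ)) := by
  by_cases h : ∀ k l, n ≠ 4 ^ k * (16 * l + 14)
  · obtain ⟨x, y, z, hxyz⟩ := exists_sq_add_sq_add_two_mul_sq h
    rcases Nat.eq_zero_or_pos x with rfl | hx
    · rcases Nat.eq_zero_or_pos y with rfl | hy
      · refine ⟨z, 0, z, 0, by rw [hxyz]; ring, Nat.pos_of_ne_zero ?_, z, by push_cast; ring⟩
        rintro rfl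
        simp at hxyz
        omega
      · exact ⟨z, z, y, 0, by rw [hxyz]; ring, hy, by simp⟩
    · exact ⟨z, z, x, y, by rw [hxyz]; ring, hx, by simp⟩
  · push Not at h
    obtain ⟨k, l, rfl⟩ := h
    obtain ⟨x, y, w, hy, -, hxy⟩ :=
      exists_sq_add_two_mul_hex_pos (k := k) (m := 16 * l + 14) (by omega)
    exact ⟨x + y, x, y, w, by rw [hxy]; ring, hy, y, by push_cast; ring⟩

/-- The legs are `4 s, 3 s` if `x = 0` and `5 s, 12 s` if `x = y + z`, where `s = y + z`. -/
theorem four_sq_legs {n : ℕ} (hn : 0 < n) :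
    ∃ x y z w : ℕ, n = x ^ 2 + y ^ 2 + z ^ 2 + w ^ 2 ∧
      0 < y ∧ AreLegsOfIntegerRightTriangle (x + 4 * y + 4 * z) (9 * x + 3 * y + 3 * z) := by
  by_cases h : ∀ k l, n ≠ 4 ^ k * (8 * l + 7)
  · obtain ⟨z, w, y, hy, hxyz⟩ := exists_sum_three_sq_pos hn h
    exact ⟨0, y, z, w, by rw [hxyz]; ring, hy, by omega, by omega, 5 * (y + z), by omega, by ring⟩
  · push Not at h
    obtain ⟨k, l, rfl⟩ := h
    obtain ⟨z, y, w, hy, -, hzy⟩ :=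
      exists_sq_add_two_mul_hex_pos (k := k) (m := 8 * l + 7) (by omega)
    exact ⟨y + z, y, z, w, by rw [hzy]; ring, hy, by omega, by omega, 13 * (y + z), by omega,
      by ring⟩

/-- Use `x = 0`, or `z = x + y` when `x² y² + y² z² + z² x² = (x² + x y + y²)²`. -/
theorem four_sq_mul_sq_isSquare {n : ℕ} (hn : 0 < n) :
    ∃ x y z w : ℕ, n = x ^ 2 + y ^ 2 + z ^ 2 + w ^ 2 ∧
      0 < w ∧ IsSquare (x ^ 2 * y ^ 2 + y ^ 2 * z ^ 2 + z ^ 2 * x ^ 2) := by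
  by_cases h : ∀ k l, n ≠ 4 ^ k * (8 * l + 7)
  · obtain ⟨y, z, w, hw, hxyz⟩ := exists_sum_three_sq_pos hn h
    exact ⟨0, y, z, w, by rw [hxyz]; ring, hw, y * z, by ring⟩
  · push Not at h
    obtain ⟨k, l, rfl⟩ := h
    obtain ⟨x, y, w, -, hw, hxy⟩ :=
      exists_sq_add_two_mul_hex_pos (k := k) (m := 8 * l + 7) (by omega)
    exact ⟨x, y, x + y, w, by rw [hxy]; ring, hw (by omega), x ^ 2 + x * y + y ^ 2, by ring⟩

/-- Use `x = 0`, or `x + y = 2 z`. With `x = z + t`, `y = z - t` the latter turns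
`x² + y² + z² + w²` into `w² + 2 t² + 3 z²` and the other expression into `(3 z² + t²)²`. -/
theorem four_sq_mul_sq_isSquare' {n : ℕ} (hn : 0 < n) :
    ∃ x y z w : ℤ, (n : ℤ) = x ^ 2 + y ^ 2 + z ^ 2 + w ^ 2 ∧
      0 < w ∧ IsSquare (x ^ 2 * y ^ 2 + 4 * y ^ 2 * z ^ 2 + 4 * z ^ 2 * x ^ 2) := by
  by_cases h : ∀ k l, n ≠ 4 ^ k * (8 * l + 7)
  · obtain ⟨y, z, w, hw, hxyz⟩ := exists_sum_three_sq_pos hn h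
    exact ⟨0, y, z, w, by rw [hxyz]; push_cast; ring, by exact_mod_cast hw, 2 * y * z, by ring⟩
  · push Not at h
    obtain ⟨k, l, rfl⟩ := h
    obtain ⟨w, t, z, hw, hwtz⟩ := exists_sq_add_two_mul_sq_add_three_mul_sq k l
    exact ⟨z + t, z - t, z, w, by rw [hwtz]; push_cast; ring, by exact_mod_cast hw,
      3 * z ^ 2 + t ^ 2, by ring⟩

/-- Use `y = 0`, or `x = y - z` when the expression is `(y + z)⁴`. -/
theorem four_sq_fourth_power {n : ℕ} (hn : 0 < n) :
    ∃ x y z w : ℕ, n = x ^ 2 + y ^ 2 + z ^ 2 + w ^ 2 ∧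
      0 < w ∧ ∃ t : ℕ, x ^ 4 + 8 * y ^ 3 * z + 8 * y * z ^ 3 = t ^ 4 := by
  by_cases h : ∀ k l, n ≠ 4 ^ k * (8 * l + 7)
  · obtain ⟨x, z, w, hw, hxyz⟩ := exists_sum_three_sq_pos hn h
    exact ⟨x, 0, z, w, by rw [hxyz]; ring, hw, x, by ring⟩
  · push Not at h
    obtain ⟨k, l, rfl⟩ := h
    obtain ⟨x, z, w, -, hw, hxz⟩ :=
      exists_sq_add_two_mul_hex_pos (k := k) (m := 8 * l + 7) (by omega)
    exact ⟨x, x + z, z, w, by rw [hxz]; ring, hw (by omega), x + 2 * z, by ring⟩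

/-- Use `y = 0`, or `x = |y - 2 z|` when the expression is `(y + 2 z)⁴`. With `y = t + z` the sum of
four squares is `w² + 2 t² + 3 z²`. -/
theorem four_sq_fourth_power' {n : ℕ} (hn : 0 < n) :
    ∃ x y z w : ℕ, n = x ^ 2 + y ^ 2 + z ^ 2 + w ^ 2 ∧
      0 < w ∧ ∃ t : ℕ, x ^ 4 + 16 * y ^ 3 * z + 64 * y * z ^ 3 = t ^ 4 := by
  by_cases h : ∀ k l, n ≠ 4 ^ k * (8 * l + 7)
  · obtain ⟨x, z, w, hw, hxyz⟩ := exists_sum_three_sq_pos hn h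
    exact ⟨x, 0, z, w, by rw [hxyz]; ring, hw, x, by ring⟩
  · push Not at h
    obtain ⟨k, l, rfl⟩ := h
    obtain ⟨w, t, z, hw, hwtz⟩ := exists_sq_add_two_mul_sq_add_three_mul_sq k l
    refine ⟨(t - z : ℤ).natAbs, t + z, z, w, ?_, hw, t + 3 * z, ?_⟩
    · zify at hwtz ⊢
      rw [sq_abs, hwtz]
      ring
    · zify
      rw [Even.pow_abs (by decide)]
      ring

theorem theorem1p4 :
    -- (i)
    (∀ P ∈ ({fun x y _ => x * (x - y),
             fun x y _ => x * (x - 2 * y),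
             fun x y _ => (x - y) * (x - 2 * y),
             fun x y _ => (x - y) * (x - 3 * y),
             fun x y z => x * (x + y - z),
             fun x y z => (x - y) * (x + y - z),
             fun x y z => (x - 2 * y) * (x + y - z)} : Set (ℤ → ℤ → ℤ → ℤ)),
      ∀ n : ℕ, ∃ x y z w : ℕ, n = x ^ 2 + y ^ 2 + z ^ 2 + w ^ 2 ∧ P x y z = 0) ∧
    -- (ii)
    ((∀ q : ℕ, ∃ x y z : ℕ, 8 * q + 5 = x ^ 2 + y ^ 2 + 13 * z ^ 2) →
      ∀ n : ℕ, ∃ x y z w : ℕ, n = x ^ 2 + y ^ 2 + z ^ 2 + w ^ 2 ∧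
        (2 * (x : ℤ) - 3 * (y : ℤ)) * ((x : ℤ) + (y : ℤ) - (z : ℤ)) = 0) ∧
    -- (iii)
    (∀ n : ℕ, 0 < n → ∃ x y z w : ℕ, n = x ^ 2 + y ^ 2 + z ^ 2 + w ^ 2 ∧
      0 < z ∧ IsSquare (((x : ℤ) - (y : ℤ)) * (z : ℤ))) ∧
    -- (iv)
    (∀ n : ℕ, 0 < n → ∃ x y z w : ℕ, n = x ^ 2 + y ^ 2 + z ^ 2 + w ^ 2 ∧
      0 < y ∧ AreLegsOfIntegerRightTriangle (x + 4 * y + 4 * z) (9 * x + 3 * y + 3 * z)) ∧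
    -- (v)
    (∀ n : ℕ, 0 < n → ∃ x y z w : ℕ, n = x ^ 2 + y ^ 2 + z ^ 2 + w ^ 2 ∧
      0 < w ∧ IsSquare (x ^ 2 * y ^ 2 + y ^ 2 * z ^ 2 + z ^ 2 * x ^ 2)) ∧
    (∀ n : ℕ, 0 < n → ∃ x y z w : ℤ, (n : ℤ) = x ^ 2 + y ^ 2 + z ^ 2 + w ^ 2 ∧
      0 < w ∧ IsSquare (x ^ 2 * y ^ 2 + 4 * y ^ 2 * z ^ 2 + 4 * z ^ 2 * x ^ 2)) ∧
    -- (vi)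
    (∀ n : ℕ, 0 < n → ∃ x y z w : ℕ, n = x ^ 2 + y ^ 2 + z ^ 2 + w ^ 2 ∧
      0 < w ∧ ∃ t : ℕ, x ^ 4 + 8 * y ^ 3 * z + 8 * y * z ^ 3 = t ^ 4) ∧
    (∀ n : ℕ, 0 < n → ∃ x y z w : ℕ, n = x ^ 2 + y ^ 2 + z ^ 2 + w ^ 2 ∧
      0 < w ∧ ∃ t : ℕ, x ^ 4 + 16 * y ^ 3 * z + 64 * y * z ^ 3 = t ^ 4) :=
  ⟨fun _ hP => four_sq_of_polynomial hP, four_sq_of_thirteen, fun _ => four_sq_sub_mul_isSquare,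
    fun _ => four_sq_legs, fun _ => four_sq_mul_sq_isSquare, fun _ => four_sq_mul_sq_isSquare',
    fun _ => four_sq_fourth_power, fun _ => four_sq_fourth_power'⟩
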